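/- Let $(S,g)$ be a rank-one Lie group of Iwasawa type, i.e. a simply connected solvable Lie group with a left-invariant Riemannian metric whose Lie algebra $\mathfrak s$ satisfies: (1) $\mathfrak s=\mathfrak a\oplus\mathfrak n$ with $\mathfrak n=[\mathfrak s,\mathfrak s]$ and $\mathfrak a=\mathfrak n^\perp$ abelian; (2) $\mathrm{ad}(H)|_{\mathfrak n}$ is symmetric for all $H\in\mathfrak a$; (3) $\mathrm{ad}(H)|_{\mathfrak n}$ is positive definite for some $H\in\mathfrak a$; and $\dim\mathfrak a=1$. Let $A\in\mathfrak a$ be a unit vector with $\mathrm{ad}(A)|_{\mathfrak n}$ positive definite, let $\lambda_1<\dots<\lambda_m$ be the distinct eigenvalues of $\mathrm{ad}(A)|_{\mathfrak n}$, with eigenspaces $\mathfrak n_1,\dots,\mathfrak n_m$ of dimensions $n_1,\dots,n_m$, and let $\{X^i_j\}_{j=1}^{n_i}$ be an orthonormal basis of $\mathfrak n_i$ for each $i$. Then $S=\mathbb R^+\ltimes N$, where $N$ is the simply connected nilpotent Lie group with Lie algebra $\mathfrak n$ and $t\in\mathbb R^+$ acts on $N$ by $\exp(X)\mapsto\exp(t^{\lambda_i}X)$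 for $X\in\mathfrak n_i$, extended linearly in exponential coordinates; the point $(t,\exp(\sum_{i,j}x^i_jX^i_j))$ of $S$ has the global coordinates $(t,x)$ with $t>0$ and $x=(x^i_j)$. Let $\tau$ be the Laplace–Beltrami operator of $(S,g)$ on complex-valued functions. For a function $h:S\to\mathbb C$ independent of $t$, the tension tree of $h$ is the collection of functions $h^i_\alpha:S\to\mathbb C$, $i\ge 0$, $\alpha\in\{1,\dots,m\}^i$, all independent of $t$, with $h^0=h$ and $$\tau(h^i_\alpha)=\sum_{k=1}^m h^{i+1}_{(\alpha,k)}\,t^{2\lambda_k}\qquad\text{for all } i\ge 0,\ \alpha\in\{1,\dots,m\}^i .$$ Its degree is the smallest $r\in\mathbb N$ such that $h^{r+1}_\alpha\equiv 0$ for all $\alpha\in\{1,\dots,m\}^{r+1}$, and $\infty$ if there is no such $r$. Theorem. For every $h:S\to\mathbb C$ that is a polynomial with complex coefficients in the coordinates $x^i_j$ (so independent of $t$), the tension tree of $h$ exists, is unique, and has finite degree. -/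

import Mathlib

noncomputable section

namespace Iwasawa

/-! ### The Baker-Campbell-Hausdorff product of a nilpotent Lie algebra -/

section BCH

variable {L : Type*} [LieRing L] [LieAlgebra ℝ L]

/-- The right-nested bracket `[a₁, [a₂, [… [aₖ₋₁, aₖ] …]]]` of a word `a₁ a₂ … aₖ`. -/
def nestedBracket : List L → L
  | [] => 0
  | [a] => a
  | a :: b :: l => ⁅a, nestedBracket (b :: l)⁆

/-- The word `X^{r₁} Y^{s₁} ⋯ X^{rₖ} Y^{sₖ}`, where `p i = (rᵢ, sᵢ)`. -/
def dynkinWord (X Y : L) {k : ℕ} (p : Fin k → ℕ × ℕ) : List L :=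
  (List.ofFn fun i => List.replicate (p i).1 X ++ List.replicate (p i).2 Y).flatten

/-- Dynkin's form of the Baker-Campbell-Hausdorff series
`∑ₖ (-1)^(k-1)/k ∑ [X^{r₁} Y^{s₁} ⋯ X^{rₖ} Y^{sₖ}] / ((∑ (rᵢ + sᵢ)) ∏ rᵢ! sᵢ!)`
(inner sum over all `(rᵢ, sᵢ) ≠ (0, 0)`), up to brackets of length `c`. On a Lie algebra that is
at most `c`-step nilpotent all the omitted brackets vanish, and this is the group law of the simply
connected Lie group with this Lie algebra in exponential coordinates:
`exp X * exp Y = exp (bch c X Y)`. -/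
def bch (c : ℕ) (X Y : L) : L :=
  ∑ k ∈ Finset.Icc 1 c,
    ∑ p ∈ (Fintype.piFinset fun _ : Fin k => Finset.range (c + 1) ×ˢ Finset.range (c + 1)) with
        (∀ i, 0 < (p i).1 + (p i).2) ∧ ∑ i, ((p i).1 + (p i).2) ≤ c,
      ((-1 : ℝ) ^ (k - 1) / (k : ℝ) /
          (((∑ i, ((p i).1 + (p i).2) : ℕ) : ℝ) *
            ∏ i, (((p i).1.factorial : ℝ) * ((p i).2.factorial : ℝ)))) •
        nestedBracket (dynkinWord X Y p)

end BCH

/-! ### Orthonormal eigenbases -/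

/-- Spectral theorem: a symmetric operator has an orthonormal eigenbasis, grouped by the strictly
increasing list of its eigenvalues. -/
theorem exists_eigenbasis_inner {E : Type*} [NormedAddCommGroup E] [InnerProductSpace ℝ E]
    [FiniteDimensional ℝ E] (T : E →ₗ[ℝ] E) (hT : T.IsSymmetric) :
    ∃ (m : ℕ) (lam : Fin m → ℝ) (dim : Fin m → ℕ)
   (X : Module.Basis (Σ i : Fin m, Fin (dim i)) ℝ E), StrictMono lam ∧ (∀ i, 0 < dim i) ∧
   (∀ p q, inner ℝ (X p) (X q) = if p = q then (1:ℝ) else 0) ∧ ∀ p, T (X p) = lam p.1 • X p := by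
  classical
  let : LinearOrder (Module.End.Eigenvalues T) :=
    LinearOrder.lift' (fun μ => (μ : ℝ)) Subtype.val_injective
  let e := Fintype.orderIsoFinOfCardEq (Module.End.Eigenvalues T) rfl
  have hf : OrthogonalFamily ℝ (fun i => Module.End.eigenspace T ((e i : Module.End.Eigenvalues T) : ℝ))
      (fun i => (Module.End.eigenspace T ((e i : Module.End.Eigenvalues T) : ℝ)).subtypeₗᵢ) :=
    hT.orthogonalFamily_eigenspaces'.comp e.injective
  have hint : DirectSum.IsInternal
      (fun i => Module.End.eigenspace T ((e i : Module.End.Eigenvalues T) : ℝ)) := by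
    rw [hf.isInternal_iff]
    rw [e.surjective.iSup_comp (g := fun μ : Module.End.Eigenvalues T => Module.End.eigenspace T (μ:ℝ))]
    exact hT.orthogonalComplement_iSup_eigenspaces_eq_bot'
  let b := hint.collectedOrthonormalBasis hf (fun i => stdOrthonormalBasis ℝ _)
  refine ⟨_, fun i => ((e i : Module.End.Eigenvalues T) : ℝ), fun i => _, b.toBasis, ?_, ?_, ?_, ?_⟩
  · intro i j hij
    exact e.strictMono hij
  · intro i
    rw [Module.finrank_pos_iff_exists_ne_zero]
    obtain ⟨v, hv⟩ := Module.End.HasEigenvalue.exists_hasEigenvector (f := T) (e i).2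
    exact ⟨⟨v, hv.1⟩, fun h => hv.2 (congrArg Subtype.val h)⟩
  · intro p q
    simpa using orthonormal_iff_ite.mp b.orthonormal p q
  · intro p
    have := hint.collectedOrthonormalBasis_mem hf (fun i => stdOrthonormalBasis ℝ _) p
    simpa using Module.End.mem_eigenspace_iff.mp this

theorem exists_eigenbasis {V : Type*} [AddCommGroup V] [Module ℝ V] [FiniteDimensional ℝ V]
   (B : LinearMap.BilinForm ℝ V) (hs : ∀ x y, B x y = B y x) (hp : ∀ x, x ≠ 0 → 0 < B x x)
  (T : V →ₗ[ℝ] V) (hT : ∀ x y, B (T x) y = B x (T y)) : ∃ (m : ℕ) (lam : Fin m → ℝ) (dim : Fin m → ℕ)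
   (X : Module.Basis (Σ i : Fin m, Fin (dim i)) ℝ V), StrictMono lam ∧ (∀ i, 0 < dim i) ∧
   (∀ p q, B (X p) (X q) = if p = q then (1:ℝ) else 0) ∧ ∀ p, T (X p) = lam p.1 • X p := by
  let c : InnerProductSpace.Core ℝ V :=
    { inner := fun x y => B x y
      conj_inner_symm := fun x y => by simpa using hs y x
      re_inner_nonneg := fun x => by
        by_cases h : x = 0
        · simp [h]
        · simpa using (hp x h).le
      add_left := by simp
      smul_left := by simp
      definite := fun x hx => by
        by_contra h
        exact (hp x h).ne' hx }
  let : NormedAddCommGroup V := c.toNormedAddCommGroup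
  let : InnerProductSpace ℝ V := InnerProductSpace.ofCore c.toCore
  exact exists_eigenbasis_inner T hT

/-! ### Metric Lie algebras of Iwasawa type -/

section MetricLieAlgebra

variable {s : Type*} [LieRing s] [LieAlgebra ℝ s]

variable (s) in
/-- The derived algebra `𝔫 = [𝔰, 𝔰]`. -/
abbrev derived : LieIdeal ℝ s := ⁅(⊤ : LieIdeal ℝ s), (⊤ : LieIdeal ℝ s)⁆

/-- The orthogonal complement `𝔞 = 𝔫^⊥` of the derived algebra. -/
def flat (g : LinearMap.BilinForm ℝ s) : Submodule ℝ s :=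
  g.orthogonal (derived s).toSubmodule

/-- The Lie algebra `𝔰`, with inner product `g`, is of Iwasawa type. The simply connected solvable
Lie groups with left-invariant metric of Iwasawa type are, up to isometric isomorphism, exactly the
simply connected Lie groups of these metric Lie algebras. -/
structure IsIwasawaType (g : LinearMap.BilinForm ℝ s) : Prop where
  symm : ∀ X Y, g X Y = g Y X
  posDef : ∀ X, X ≠ 0 → 0 < g X X
  solvable : LieAlgebra.IsSolvable s
  isCompl : IsCompl (flat g) (derived s).toSubmodule
  abelian : ∀ H ∈ flat g, ∀ H' ∈ flat g, ⁅H, H'⁆ = 0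
  ad_symmetric : ∀ H ∈ flat g, ∀ X ∈ derived s, ∀ Y ∈ derived s, g ⁅H, X⁆ Y = g X ⁅H, Y⁆
  ad_posDef : ∃ H ∈ flat g, ∀ X ∈ derived s, X ≠ 0 → 0 < g ⁅H, X⁆ X

/-- The rank of a Lie algebra of Iwasawa type: the dimension of `𝔞`. -/
def rank (g : LinearMap.BilinForm ℝ s) : ℕ := Module.finrank ℝ (flat g)

/-- The standard notation on a rank-one Lie algebra of Iwasawa type: the unit vector `A ∈ 𝔞` for
which `ad A` is positive definite on `𝔫`, the distinct eigenvalues `λ₁ < … < λₘ` of `ad A` on `𝔫`,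
the dimensions `nᵢ > 0` of the eigenspaces `𝔫ᵢ`, and an orthonormal basis `Xⁱⱼ ∈ 𝔫ᵢ` of `𝔫`. -/
structure AdaptedFrame (g : LinearMap.BilinForm ℝ s) where
  A : s
  A_mem : A ∈ flat g
  A_unit : g A A = 1
  A_posDef : ∀ X ∈ derived s, X ≠ 0 → 0 < g ⁅A, X⁆ X
  /-- the number of distinct eigenvalues -/
  m : ℕ
  /-- the eigenvalues -/
  lam : Fin m → ℝ
  lam_strictMono : StrictMono lam
  /-- the dimensions of the eigenspaces -/
  dim : Fin m → ℕ
  dim_pos : ∀ i, 0 < dim i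
  X : Module.Basis (Σ i : Fin m, Fin (dim i)) ℝ (derived s)
  orthonormal : ∀ p q, g (X p : s) (X q : s) = if p = q then 1 else 0
  eigen : ∀ p, ⁅A, (X p : s)⁆ = lam p.1 • (X p : s)

/-- Every rank-one Lie algebra of Iwasawa type has an adapted frame. -/
theorem AdaptedFrame.nonempty [FiniteDimensional ℝ s]
    (g : LinearMap.BilinForm ℝ s) (hg : IsIwasawaType g) (hrank : rank g = 1) :
    Nonempty (AdaptedFrame g) := by
  obtain ⟨H, hH, hH0, hpos⟩ : ∃ H ∈ flat g, H ≠ 0 ∧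
      ∀ X ∈ derived s, X ≠ 0 → 0 < g ⁅H, X⁆ X := by
    obtain ⟨H, hH, hpos⟩ := hg.ad_posDef
    by_cases h0 : H = 0
    · obtain ⟨v, hv⟩ := Module.finrank_pos_iff_exists_ne_zero.mp
        (show 0 < Module.finrank ℝ (flat g) by rw [show Module.finrank ℝ (flat g) = 1 from hrank]; norm_num)
      refine ⟨v, v.2, fun h => hv (Subtype.ext h), fun X hX hX0 => ?_⟩
      have := hpos X hX hX0
      simp [h0] at this
    · exact ⟨H, hH, h0, hpos⟩
  have hc : 0 < (Real.sqrt (g H H))⁻¹ := inv_pos.mpr (Real.sqrt_pos.mpr (hg.posDef H hH0))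
  set c := (Real.sqrt (g H H))⁻¹ with hcdef
  have hA : c • H ∈ flat g := (flat g).smul_mem c hH
  let T : derived s →ₗ[ℝ] derived s :=
    { toFun := fun X => ⁅c • H, X⁆
      map_add' := by simp
      map_smul' := by simp }
  have hT : ∀ X, ((T X : derived s) : s) = ⁅c • H, (X : s)⁆ := fun X => rfl
  obtain ⟨m, lam, dim, X, h1, h2, h3, h4⟩ := exists_eigenbasis
    (g.restrict (derived s).toSubmodule) (fun x y => hg.symm x y)
    (fun x hx => hg.posDef x (fun h => hx (Subtype.ext h))) T
    (fun x y => hg.ad_symmetric _ hA x x.2 y y.2)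
  refine ⟨⟨c • H, hA, ?_, ?_, m, lam, h1, dim, h2, X, h3, ?_⟩⟩
  · have := hg.posDef H hH0
    simp only [map_smul, LinearMap.smul_apply, smul_eq_mul, hcdef]
    have h2 := Real.mul_self_sqrt this.le
    have h3 := Real.sqrt_pos.mpr this
    field_simp
    nlinarith
  · intro X hX hX0
    simpa using mul_pos hc (hpos X hX hX0)
  · intro p
    rw [← hT, h4]; rfl

namespace AdaptedFrame

variable {g : LinearMap.BilinForm ℝ s} (F : AdaptedFrame g)

/-- The indices `(i, j)`, `1 ≤ i ≤ m`, `1 ≤ j ≤ nᵢ`, of the coordinates `xⁱⱼ`. -/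
abbrev Index : Type := Σ i : Fin F.m, Fin (F.dim i)

/-! ### The group `S = ℝ⁺ ⋉ N` -/

/-- The simply connected Lie group `S = ℝ⁺ ⋉ N` with Lie algebra `𝔰`. The point `(t, exp x)` is
recorded by `t > 0` and `x ∈ 𝔫`, the exponential map `𝔫 → N` being a diffeomorphism. -/
@[ext]
structure Group (F : AdaptedFrame g) where
  t : ℝ
  t_pos : 0 < t
  x : derived s

/-- The automorphism `μ(t)` of `N` in exponential coordinates: multiplication by `t ^ λᵢ` on the
eigenspace `𝔫ᵢ`. -/
def dilation (t : ℝ) : derived s →ₗ[ℝ] derived s :=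
  F.X.constr ℝ fun p => t ^ F.lam p.1 • F.X p

/-- The group law `(t, exp X) (t', exp Y) = (t t', exp X · exp (μ(t) Y))`. The Lie algebra `𝔫` is at
most `m`-step nilpotent. -/
instance : Mul F.Group where
  mul p q := ⟨p.t * q.t, mul_pos p.t_pos q.t_pos, bch F.m p.x (F.dilation p.t q.x)⟩

/-! ### The Laplace-Beltrami operator -/

/-- The orthonormal basis of `𝔰` consisting of `A` (index `none`) and the `Xⁱⱼ`. -/
def frame : Option F.Index → s
  | none => F.A
  | some p => F.X p

/-- The one-parameter subgroups `r ↦ exp (r A) = (e^r, 1)` and `r ↦ exp (r Xⁱⱼ) = (1, exp (r Xⁱⱼ))`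
of `S`. -/
def oneParam (a : Option F.Index) (r : ℝ) : F.Group :=
  match a with
  | none => ⟨Real.exp r, Real.exp_pos r, 0⟩
  | some p => ⟨1, one_pos, r • F.X p⟩

/-- The derivative of `φ` along the left-invariant vector field with value `frame a` at the neutral
element. -/
def leftInvariant (a : Option F.Index) (φ : F.Group → ℂ) (q : F.Group) : ℂ :=
  deriv (fun r : ℝ => φ (q * F.oneParam a r)) 0

/-- The components `⟨∇_{E_a} E_b, E_c⟩` of the Levi-Civita connection of the left-invariant metric
in the orthonormal frame, by the Koszul formula. -/
def connection (a b c : Option F.Index) : ℝ :=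
  (g ⁅F.frame a, F.frame b⁆ (F.frame c) - g ⁅F.frame b, F.frame c⁆ (F.frame a)
    + g ⁅F.frame c, F.frame a⁆ (F.frame b)) / 2

/-- The Laplace-Beltrami operator `τ = ∑ₐ (E_a E_a - ∇_{E_a} E_a)` of the left-invariant metric. -/
def tau (φ : F.Group → ℂ) (q : F.Group) : ℂ :=
  ∑ a, (F.leftInvariant a (F.leftInvariant a φ) q
    - ∑ c, (F.connection a a c : ℂ) * F.leftInvariant c φ q)

/-! ### Tension trees -/

/-- `φ` is independent of the coordinate `t`. -/
def IndependentOfT (φ : F.Group → ℂ) : Prop :=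
  ∀ p q : F.Group, p.x = q.x → φ p = φ q

/-- `h` is a polynomial in the coordinates `xⁱⱼ`, with complex coefficients. -/
def IsPolynomialInX (h : F.Group → ℂ) : Prop :=
  ∃ P : MvPolynomial F.Index ℂ, ∀ q : F.Group,
    h q = MvPolynomial.eval (fun p => (F.X.repr q.x p : ℂ)) P

/-- A family of functions `h^i_α` on `S`, `i ∈ ℕ`, `α ∈ {1, …, m}^i`. -/
abbrev Tree : Type _ := (i : ℕ) → (Fin i → Fin F.m) → F.Group → ℂ

/-- `T` is the tension tree of `h`, with `h` itself as its node at level `0`. -/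
structure IsTensionTree (h : F.Group → ℂ) (T : F.Tree) : Prop where
  root : ∀ α, T 0 α = h
  independent : ∀ i α, F.IndependentOfT (T i α)
  tau_eq : ∀ i α (q : F.Group), F.tau (T i α) q =
    ∑ k : Fin F.m, T (i + 1) (Fin.snoc (α := fun _ => Fin F.m) α k) q *
      ((q.t ^ (2 * F.lam k) : ℝ) : ℂ)

/-- The degree of a tension tree: the smallest `r` such that all nodes at level `r + 1` vanish
identically, and `⊤` if there is no such `r`. -/
def degree (T : F.Tree) : ℕ∞ :=
  ⨅ (r : ℕ) (_ : ∀ α : Fin (r + 1) → Fin F.m, ∀ q, T (r + 1) α q = 0), (r : ℕ∞)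

end AdaptedFrame

end MetricLieAlgebra

end Iwasawa

end

noncomputable section

namespace Iwasawa

/-! ### Naturality and closure properties of the Baker-Campbell-Hausdorff product -/

section BCH

/-! On functions independent of `t`, `A` acts as zero and `Xⁱⱼ` acts as `t ^ λᵢ` times a vector
field on `N`. The correction `∑ₐ ∇_{E_a} E_a` is a multiple of `A`, so `τ f = ∑ₖ t ^ (2 λₖ) τₖ f`
with `τₖ` the sum of squares of the fields from `𝔫ₖ` (`tau_eq_sum_tension`). Iterating the `τₖ`
builds a tree. It is the only one, since the powers `t ^ (2 λₖ)` are linearly independent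
(`eq_zero_of_sum_rpow`).

Finite degree is a weight argument. The dilations are automorphisms of `𝔫`, so each field `Xⁱⱼ`
lowers homogeneous weight by `λᵢ` (`IsHomogeneous.fieldDeriv`), and it preserves polynomials because
`bch` is polynomial in coordinates (`hasDerivAt_fieldDeriv`). Each level of the tree thus lowers the
weight by at least `2 λ₁ > 0`, and a polynomial of negative weight is zero
(`IsHomogeneous.eq_zero`). Of `bch` only naturality and polynomiality are used, not the group
axioms. -/

theorem map_dynkinWord {L M : Type*} (φ : L → M) (X Y : L) {k : ℕ} (p : Fin k → ℕ × ℕ) :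
    (dynkinWord X Y p).map φ = dynkinWord (φ X) (φ Y) p := by
  simp only [dynkinWord, List.map_flatten, List.map_ofFn]
  congr 2
  funext i
  simp

variable {L M : Type*} [LieRing L] [LieAlgebra ℝ L] [LieRing M] [LieAlgebra ℝ M]

theorem map_nestedBracket (φ : L →ₗ⁅ℝ⁆ M) :
    ∀ l : List L, φ (nestedBracket l) = nestedBracket (l.map φ)
  | [] => by simp [nestedBracket]
  | [a] => by simp [nestedBracket]
  | a :: b :: l => by
    have := map_nestedBracket φ (b :: l)
    simp only [List.map_cons] at this
    simp only [nestedBracket, List.map_cons, LieHom.map_lie, this]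

theorem map_bch (φ : L →ₗ⁅ℝ⁆ M) (c : ℕ) (X Y : L) :
    φ (bch c X Y) = bch c (φ X) (φ Y) := by
  simp only [bch, ← LieHom.coe_toLinearMap, map_sum, map_smul]
  simp only [LieHom.coe_toLinearMap, map_nestedBracket, map_dynkinWord]

/-- A space of functions closed under pointwise brackets is closed under pointwise `bch`. -/
theorem bch_mem {ι : Type*} (K : Submodule ℝ (ι → L))
    (hK : ∀ Z ∈ K, ∀ Z' ∈ K, (fun i => ⁅Z i, Z' i⁆) ∈ K) (c : ℕ) {Z Z' : ι → L}
    (hZ : Z ∈ K) (hZ' : Z' ∈ K) : (fun i => bch c (Z i) (Z' i)) ∈ K := by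
  -- Words are encoded by Boolean letters, so that one induction treats all `i` at once.
  have hword : ∀ w : List Bool,
      (fun i => nestedBracket (w.map fun b => cond b (Z i) (Z' i))) ∈ K := by
    have hletter : ∀ b : Bool, (fun i => cond b (Z i) (Z' i)) ∈ K := by
      intro b
      cases b <;> assumption
    intro w
    induction w with
    | nil => exact K.zero_mem
    | cons b l ih =>
      cases l with
      | nil => exact hletter b
      | cons b' l => exact hK _ (hletter b) _ ih
  have h : ∀ (k : ℕ) (p : Fin k → ℕ × ℕ),
      (fun i => nestedBracket (dynkinWord (Z i) (Z' i) p)) ∈ K := by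
    intro k p
    convert hword (dynkinWord true false p) using 3 with i
    rw [map_dynkinWord]
    rfl
  have hbch : (fun i => bch c (Z i) (Z' i)) = ∑ k ∈ Finset.Icc 1 c,
      ∑ p ∈ (Fintype.piFinset fun _ : Fin k => Finset.range (c + 1) ×ˢ Finset.range (c + 1)) with
        (∀ i, 0 < (p i).1 + (p i).2) ∧ ∑ i, ((p i).1 + (p i).2) ≤ c,
      ((-1 : ℝ) ^ (k - 1) / (k : ℝ) /
          (((∑ i, ((p i).1 + (p i).2) : ℕ) : ℝ) *
            ∏ i, (((p i).1.factorial : ℝ) * ((p i).2.factorial : ℝ)))) •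
        (fun i => nestedBracket (dynkinWord (Z i) (Z' i) p)) := by
    funext i
    simp only [bch, Finset.sum_apply, Pi.smul_apply]
  rw [hbch]
  exact sum_mem fun k _ => sum_mem fun p _ => K.smul_mem _ (h k p)

end BCH

/-- Powers `t ^ μₖ` with distinct real exponents are linearly independent on `t > 0`. -/
theorem eq_zero_of_sum_rpow {ι : Type*} [Fintype ι] {μ : ι → ℝ}
    (hμ : Function.Injective μ) (c : ι → ℂ)
    (h : ∀ t : ℝ, 0 < t → ∑ k, c k * ((t ^ μ k : ℝ) : ℂ) = 0) : c = 0 := by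
  -- With `t = exp x` the powers become distinct characters of the additive group of reals, which
  -- are independent by Dedekind's lemma.
  let χ : ι → Multiplicative ℝ →* ℂ := fun k =>
    { toFun := fun x => ((Real.exp (x.toAdd * μ k) : ℝ) : ℂ)
      map_one' := by simp
      map_mul' := fun x y => by
        rw [toAdd_mul, add_mul, Real.exp_add, Complex.ofReal_mul] }
  have hχ : Function.Injective χ := by
    intro k k' hk
    have h1 : ((Real.exp (1 * μ k) : ℝ) : ℂ) = ((Real.exp (1 * μ k') : ℝ) : ℂ) :=
      DFunLike.congr_fun hk (Multiplicative.ofAdd 1)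
    exact hμ (by simpa using Real.exp_injective (Complex.ofReal_injective h1))
  have hli := (linearIndependent_monoidHom (Multiplicative ℝ) ℂ).comp χ hχ
  refine funext (Fintype.linearIndependent_iff.mp hli c (funext fun x => ?_))
  have h2 := h (Real.exp x.toAdd) (Real.exp_pos _)
  simp only [← Real.exp_mul] at h2
  simpa [χ, Finset.sum_apply] using h2

namespace AdaptedFrame

variable {s : Type*} [LieRing s] [LieAlgebra ℝ s] {g : LinearMap.BilinForm ℝ s}
  (F : AdaptedFrame g)

/-! ### Dilations -/

theorem lam_pos (i : Fin F.m) : 0 < F.lam i := by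
  let p : F.Index := ⟨i, ⟨0, F.dim_pos i⟩⟩
  have h := F.A_posDef (F.X p) (F.X p).2 fun h => F.X.ne_zero p (Subtype.ext h)
  rw [F.eigen, map_smul, LinearMap.smul_apply, F.orthonormal, if_pos rfl] at h
  simpa using h

theorem repr_lie_A (z : derived s) (p : F.Index) :
    F.X.repr ⁅F.A, z⁆ p = F.lam p.1 * F.X.repr z p := by
  classical
  have h : F.X.coord p ∘ₗ (LieModule.toEnd ℝ s (derived s) F.A) = F.lam p.1 • F.X.coord p := by
    refine F.X.ext fun q => ?_
    have : ⁅F.A, F.X q⁆ = F.lam q.1 • F.X q := Subtype.ext (F.eigen q)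
    by_cases hq : q = p
    · subst hq
      simp [this]
    · simp [this, hq]
  exact LinearMap.congr_fun h z

theorem repr_eq_zero_of_lie_A {z : derived s} {μ : ℝ} (hz : ⁅F.A, z⁆ = μ • z) {p : F.Index}
    (hp : F.lam p.1 ≠ μ) : F.X.repr z p = 0 := by
  have h := F.repr_lie_A z p
  rw [hz, map_smul, Finsupp.smul_apply, smul_eq_mul] at h
  have : (F.lam p.1 - μ) * F.X.repr z p = 0 := by linarith
  exact (mul_eq_zero.mp this).resolve_left (sub_ne_zero.mpr hp)

theorem lie_A_lie_X (p q : F.Index) :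
    ⁅F.A, ⁅F.X p, F.X q⁆⁆ = (F.lam p.1 + F.lam q.1) • ⁅F.X p, F.X q⁆ := by
  apply Subtype.ext
  change ⁅F.A, ⁅(F.X p : s), (F.X q : s)⁆⁆ = (F.lam p.1 + F.lam q.1) • ⁅(F.X p : s), (F.X q : s)⁆
  rw [leibniz_lie, F.eigen, F.eigen, smul_lie, lie_smul, add_smul]

theorem repr_dilation (t : ℝ) (z : derived s) (p : F.Index) :
    F.X.repr (F.dilation t z) p = t ^ F.lam p.1 * F.X.repr z p := by
  classical
  have h : F.X.coord p ∘ₗ F.dilation t = (t ^ F.lam p.1) • F.X.coord p := by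
    refine F.X.ext fun q => ?_
    by_cases hq : q = p
    · subst hq
      simp [dilation]
    · simp [dilation, hq]
  exact LinearMap.congr_fun h z

theorem dilation_X (t : ℝ) (p : F.Index) : F.dilation t (F.X p) = t ^ F.lam p.1 • F.X p := by
  simp [dilation]

/-- If `μ` is not an eigenvalue then `z = 0`, so no case split is needed when this is applied to `⁅X
p, X q⁆` with `μ` a sum of two eigenvalues. -/
theorem dilation_of_lie_A (t : ℝ) {z : derived s} {μ : ℝ} (hz : ⁅F.A, z⁆ = μ • z) :
    F.dilation t z = t ^ μ • z := by
  apply F.X.repr.injective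
  ext p
  rw [F.repr_dilation, map_smul, Finsupp.smul_apply, smul_eq_mul]
  by_cases hp : F.lam p.1 = μ
  · rw [hp]
  · rw [F.repr_eq_zero_of_lie_A hz hp, mul_zero, mul_zero]

/-- Since `ad A` is a derivation, weights add under the bracket, matching `t ^ (λ + λ') = t ^ λ * t
^ λ'`. -/
theorem dilation_lie {t : ℝ} (ht : 0 < t) (x y : derived s) :
    F.dilation t ⁅x, y⁆ = ⁅F.dilation t x, F.dilation t y⁆ := by
  rw [← F.X.sum_repr x, ← F.X.sum_repr y]
  simp only [sum_lie, lie_sum, smul_lie, lie_smul, map_sum, map_smul, F.dilation_X,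
    F.dilation_of_lie_A t (F.lie_A_lie_X _ _), Real.rpow_add ht, mul_smul]
  refine Finset.sum_congr rfl fun q _ => congrArg _ ?_
  rw [Finset.smul_sum]
  refine Finset.sum_congr rfl fun p _ => ?_
  module

/-- For `t > 0` the dilation `μ(t)` is an automorphism of the Lie algebra `𝔫`. -/
def dilationHom {t : ℝ} (ht : 0 < t) : derived s →ₗ⁅ℝ⁆ derived s :=
  { F.dilation t with map_lie' := F.dilation_lie ht _ _ }

theorem dilation_bch {t : ℝ} (ht : 0 < t) (c : ℕ) (x y : derived s) :
    F.dilation t (bch c x y) = bch c (F.dilation t x) (F.dilation t y) :=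
  map_bch (F.dilationHom ht) c x y

/-! ### Polynomial functions on `𝔫` -/

/-- The coordinate function `xⁱⱼ` on `𝔫`. -/
def coordFn (p : F.Index) (x : derived s) : ℂ := F.X.repr x p

/-- The algebra of polynomial functions on `𝔫`. -/
def polyFn : Subalgebra ℂ (derived s → ℂ) := Algebra.adjoin ℂ (Set.range F.coordFn)

theorem coordFn_mem (p : F.Index) : F.coordFn p ∈ F.polyFn :=
  Algebra.subset_adjoin ⟨p, rfl⟩

/-- The algebra of functions of `r ∈ ℝ` and `x ∈ 𝔫` that are polynomial in `r` with coefficients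
polynomial functions of `x`. -/
def polyCurve : Subalgebra ℂ (ℝ × derived s → ℂ) where
  carrier := {Φ | ∃ P : Polynomial F.polyFn, ∀ r x,
    Φ (r, x) = (P.eval (algebraMap ℂ F.polyFn r) : F.polyFn).1 x}
  mul_mem' := by
    rintro Φ Ψ ⟨P, hP⟩ ⟨Q, hQ⟩
    exact ⟨P * Q, fun r x => by simp [hP, hQ]⟩
  add_mem' := by
    rintro Φ Ψ ⟨P, hP⟩ ⟨Q, hQ⟩
    exact ⟨P + Q, fun r x => by simp [hP, hQ]⟩
  algebraMap_mem' a := ⟨Polynomial.C (algebraMap ℂ F.polyFn a), fun r x => by simp⟩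

theorem const_mem_polyCurve {f : derived s → ℂ} (hf : f ∈ F.polyFn) :
    (fun z => f z.2) ∈ F.polyCurve :=
  ⟨Polynomial.C ⟨f, hf⟩, fun r x => by simp⟩

theorem param_mem_polyCurve : (fun z => (z.1 : ℂ)) ∈ F.polyCurve :=
  ⟨Polynomial.X, fun r x => by simp⟩

theorem hasDerivAt_of_mem_polyCurve {Φ : ℝ × derived s → ℂ} (hΦ : Φ ∈ F.polyCurve) :
    ∃ f ∈ F.polyFn, ∀ x, HasDerivAt (fun r => Φ (r, x)) (f x) 0 := by
  obtain ⟨P, hP⟩ := hΦ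
  refine ⟨_, (P.derivative.eval (algebraMap ℂ F.polyFn 0)).2, fun x => ?_⟩
  -- Evaluation at `x` turns `P` into a complex polynomial in one variable, differentiated along the
  -- real line.
  let ev : F.polyFn →+* ℂ := (Pi.evalRingHom (fun _ => ℂ) x).comp F.polyFn.subtype
  have hev : ∀ (Q : Polynomial F.polyFn) (z : ℂ),
      (Q.eval (algebraMap ℂ F.polyFn z) : F.polyFn).1 x = (Q.map ev).eval z := by
    intro Q z
    rw [show z = ev (algebraMap ℂ F.polyFn z) from rfl, Polynomial.eval_map_apply]
    rfl
  simp only [hP, hev]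
  rw [← Polynomial.derivative_map]
  have h := ((P.map ev).hasDerivAt ((0 : ℝ) : ℂ)).comp_ofReal
  simpa using h

/-- The maps `ℝ × 𝔫 → 𝔫` with coordinates in `polyCurve`. -/
def polyCurveMap : Submodule ℝ (ℝ × derived s → derived s) where
  carrier := {Z | ∀ p, (fun z => F.coordFn p (Z z)) ∈ F.polyCurve}
  zero_mem' p := by
    convert F.polyCurve.zero_mem using 1
    funext z
    simp [coordFn]
  add_mem' {Z Z'} h h' p := by
    convert F.polyCurve.add_mem (h p) (h' p) using 1
    funext z
    simp [coordFn]
  smul_mem' c Z h p := by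
    convert F.polyCurve.smul_mem (h p) (c : ℂ) using 1
    funext z
    simp [coordFn]

/-- The coordinates of a bracket are bilinear in those of its entries, with the structure constants
as coefficients. -/
theorem lie_mem_polyCurveMap (Z : ℝ × derived s → derived s) (h : Z ∈ F.polyCurveMap)
    (Z' : ℝ × derived s → derived s) (h' : Z' ∈ F.polyCurveMap) :
    (fun z => ⁅Z z, Z' z⁆) ∈ F.polyCurveMap := by
  intro p
  have key : (fun z => F.coordFn p ⁅Z z, Z' z⁆) = ∑ a, ∑ b, (F.coordFn p ⁅F.X a, F.X b⁆ : ℂ) •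
      ((fun z => F.coordFn a (Z z)) * (fun z => F.coordFn b (Z' z))) := by
    funext z
    conv_lhs => rw [← F.X.sum_repr (Z z), ← F.X.sum_repr (Z' z)]
    simp only [coordFn, sum_lie, lie_sum, smul_lie, lie_smul, map_sum, map_smul,
      Finsupp.coe_finsetSum, Finset.sum_apply, smul_eq_mul, Pi.smul_apply,
      Pi.mul_apply, Complex.ofReal_sum, Complex.ofReal_mul, Finsupp.coe_smul]
    rw [Finset.sum_comm]
    refine Finset.sum_congr rfl fun b _ => ?_
    rw [Finset.mul_sum]
    refine Finset.sum_congr rfl fun a _ => ?_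
    ring
  rw [key]
  exact sum_mem fun a _ => sum_mem fun b _ =>
    F.polyCurve.smul_mem (F.polyCurve.mul_mem (h a) (h' b)) _

theorem comp_mem_polyCurve {f : derived s → ℂ} (hf : f ∈ F.polyFn)
    {Z : ℝ × derived s → derived s} (hZ : Z ∈ F.polyCurveMap) :
    (fun z => f (Z z)) ∈ F.polyCurve := by
  induction hf using Algebra.adjoin_induction with
  | mem f hf =>
    obtain ⟨p, rfl⟩ := hf
    exact hZ p
  | algebraMap a => exact F.polyCurve.algebraMap_mem a
  | add f f' _ _ h h' => exact F.polyCurve.add_mem h h'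
  | mul f f' _ _ h h' => exact F.polyCurve.mul_mem h h'

theorem bch_mem_polyCurveMap (p : F.Index) :
    (fun z : ℝ × derived s => bch F.m z.2 (z.1 • F.X p)) ∈ F.polyCurveMap := by
  refine bch_mem F.polyCurveMap F.lie_mem_polyCurveMap F.m
    (fun q => F.const_mem_polyCurve (F.coordFn_mem q)) fun q => ?_
  convert F.polyCurve.smul_mem F.param_mem_polyCurve (F.coordFn q (F.X p)) using 1
  funext z
  simp only [coordFn, map_smul, Finsupp.smul_apply, Pi.smul_apply, smul_eq_mul,
    Complex.ofReal_mul]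
  ring

/-! ### The left-invariant derivatives on functions independent of `t` -/

/-- The left-invariant vector field `Xⁱⱼ` of `N` in exponential coordinates. -/
def fieldDeriv (p : F.Index) (f : derived s → ℂ) (x : derived s) : ℂ :=
  deriv (fun r : ℝ => f (bch F.m x (r • F.X p))) 0

/-- Differentiability is recorded because `deriv` defaults to zero without it; additivity of
`fieldDeriv` depends on it. -/
theorem hasDerivAt_fieldDeriv (p : F.Index) {f : derived s → ℂ} (hf : f ∈ F.polyFn) :
    F.fieldDeriv p f ∈ F.polyFn ∧
      ∀ x, HasDerivAt (fun r : ℝ => f (bch F.m x (r • F.X p))) (F.fieldDeriv p f x) 0 := by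
  obtain ⟨f', hf', h⟩ :=
    F.hasDerivAt_of_mem_polyCurve (F.comp_mem_polyCurve hf (F.bch_mem_polyCurveMap p))
  obtain rfl : F.fieldDeriv p f = f' := funext fun x => (h x).deriv
  exact ⟨hf', h⟩

theorem fieldDeriv_mem (p : F.Index) {f : derived s → ℂ} (hf : f ∈ F.polyFn) :
    F.fieldDeriv p f ∈ F.polyFn :=
  (F.hasDerivAt_fieldDeriv p hf).1

theorem fieldDeriv_add (p : F.Index) {f f' : derived s → ℂ} (hf : f ∈ F.polyFn)
    (hf' : f' ∈ F.polyFn) : F.fieldDeriv p (f + f') = F.fieldDeriv p f + F.fieldDeriv p f' :=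
  funext fun x =>
    (((F.hasDerivAt_fieldDeriv p hf).2 x).add ((F.hasDerivAt_fieldDeriv p hf').2 x)).deriv

theorem fieldDeriv_smul (p : F.Index) (c : ℂ) (f : derived s → ℂ) :
    F.fieldDeriv p (c • f) = c • F.fieldDeriv p f :=
  funext fun _ => deriv_const_smul_field c _

/-- `f` is homogeneous of degree `e` for the dilations `μ(t)`. -/
def IsHomogeneous (e : ℝ) (f : derived s → ℂ) : Prop :=
  ∀ t : ℝ, 0 < t → ∀ x, f (F.dilation t x) = ((t ^ e : ℝ) : ℂ) * f x

/-- As `μ(t)` is an automorphism, `μ(t) x · exp (r X p) = μ(t) (x · exp (t ^ (-λ) r X p))`;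
rescaling `r` gives the factor `t ^ (-λ)`. -/
theorem IsHomogeneous.fieldDeriv {F : AdaptedFrame g} {e : ℝ} {f : derived s → ℂ}
    (hf : F.IsHomogeneous e f) (p : F.Index) :
    F.IsHomogeneous (e - F.lam p.1) (F.fieldDeriv p f) := by
  intro t ht x
  have h0 : t ^ F.lam p.1 ≠ 0 := (Real.rpow_pos_of_pos ht _).ne'
  have h : ∀ r : ℝ, f (bch F.m (F.dilation t x) (r • F.X p)) =
      ((t ^ e : ℝ) : ℂ) * f (bch F.m x (((t ^ F.lam p.1)⁻¹ * r) • F.X p)) := by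
    intro r
    rw [← hf t ht, F.dilation_bch ht, map_smul, F.dilation_X, smul_smul, mul_right_comm,
      inv_mul_cancel₀ h0, one_mul]
  simp only [AdaptedFrame.fieldDeriv, h, deriv_const_mul_field]
  rw [deriv_comp_mul_left (t ^ F.lam p.1)⁻¹ (fun r : ℝ => f (bch F.m x (r • F.X p))) 0,
    mul_zero, Real.rpow_sub ht, Complex.real_smul]
  push_cast
  ring

/-- Polynomial functions of weighted degree at most `d`. -/
def weightLE (d : ℝ) : Submodule ℂ (derived s → ℂ) :=
  Submodule.span ℂ {f | f ∈ F.polyFn ∧ ∃ e ≤ d, F.IsHomogeneous e f}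

theorem weightLE_mono {d d' : ℝ} (h : d ≤ d') : F.weightLE d ≤ F.weightLE d' :=
  Submodule.span_mono fun _ ⟨hf, e, he, h'⟩ => ⟨hf, e, he.trans h, h'⟩

theorem mem_polyFn_of_mem_weightLE {d : ℝ} {f : derived s → ℂ} (hf : f ∈ F.weightLE d) :
    f ∈ F.polyFn :=
  (Submodule.span_le (p := Subalgebra.toSubmodule F.polyFn)).mpr (fun _ h => h.1) hf

theorem fieldDeriv_mem_weightLE (p : F.Index) {d : ℝ} {f : derived s → ℂ}
    (hf : f ∈ F.weightLE d) : F.fieldDeriv p f ∈ F.weightLE (d - F.lam p.1) := by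
  induction hf using Submodule.span_induction with
  | mem f hf =>
    obtain ⟨hf, e, he, h⟩ := hf
    exact Submodule.subset_span ⟨F.fieldDeriv_mem p hf, _, by linarith, h.fieldDeriv p⟩
  | zero =>
    have := F.fieldDeriv_smul p 0 0
    rw [zero_smul, zero_smul] at this
    rw [this]
    exact zero_mem _
  | add f f' hf hf' h h' =>
    rw [F.fieldDeriv_add p (F.mem_polyFn_of_mem_weightLE hf) (F.mem_polyFn_of_mem_weightLE hf')]
    exact add_mem h h'
  | smul c f _ h =>
    rw [F.fieldDeriv_smul]
    exact Submodule.smul_mem _ c h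

theorem coordFn_isHomogeneous (p : F.Index) : F.IsHomogeneous (F.lam p.1) (F.coordFn p) := by
  intro t _ x
  simp only [coordFn, F.repr_dilation]
  push_cast
  ring

theorem mul_coordFn_mem_weightLE (p : F.Index) {d : ℝ} {f : derived s → ℂ}
    (hf : f ∈ F.weightLE d) : f * F.coordFn p ∈ F.weightLE (d + F.lam p.1) := by
  induction hf using Submodule.span_induction with
  | mem f hf =>
    obtain ⟨hf, e, he, h⟩ := hf
    refine Submodule.subset_span ⟨F.polyFn.mul_mem hf (F.coordFn_mem p), e + F.lam p.1,
      by linarith, fun t ht x => ?_⟩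
    rw [Pi.mul_apply, Pi.mul_apply, h t ht, F.coordFn_isHomogeneous p t ht, Real.rpow_add ht]
    push_cast
    ring
  | zero => simp
  | add f f' _ _ h h' => rw [add_mul]; exact add_mem h h'
  | smul c f _ h => rw [smul_mul_assoc]; exact Submodule.smul_mem _ c h

theorem exists_mem_weightLE (P : MvPolynomial F.Index ℂ) :
    ∃ d, (fun x => MvPolynomial.eval (fun p => F.coordFn p x) P) ∈ F.weightLE d := by
  induction P using MvPolynomial.induction_on with
  | C a =>
    refine ⟨0, Submodule.subset_span ⟨?_, 0, le_rfl, fun t _ x => by simp⟩⟩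
    convert F.polyFn.algebraMap_mem a using 1
    funext x
    simp
  | add P Q hP hQ =>
    obtain ⟨d, hP⟩ := hP
    obtain ⟨d', hQ⟩ := hQ
    refine ⟨max d d', ?_⟩
    simp only [map_add]
    exact add_mem (F.weightLE_mono (le_max_left _ _) hP) (F.weightLE_mono (le_max_right _ _) hQ)
  | mul_X P p hP =>
    obtain ⟨d, hP⟩ := hP
    refine ⟨d + F.lam p.1, ?_⟩
    simp only [map_mul, MvPolynomial.eval_X]
    exact F.mul_coordFn_mem_weightLE p hP

open Filter Topology in
theorem tendsto_dilation {f : derived s → ℂ} (hf : f ∈ F.polyFn) (x : derived s) :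
    Tendsto (fun t : ℝ => f (F.dilation t x)) (𝓝[>] 0) (𝓝 (f 0)) := by
  induction hf using Algebra.adjoin_induction with
  | mem f hf =>
    obtain ⟨p, rfl⟩ := hf
    have h : Tendsto (fun t : ℝ => t ^ F.lam p.1) (𝓝[>] 0) (𝓝 0) := by
      have := (Real.continuousAt_rpow_const 0 (F.lam p.1) (Or.inr (F.lam_pos p.1).le)).tendsto
      rw [Real.zero_rpow (F.lam_pos p.1).ne'] at this
      exact this.mono_left nhdsWithin_le_nhds
    have h' := (Complex.continuous_ofReal.tendsto _).comp (h.mul_const (F.X.repr x p))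
    simpa [coordFn, F.repr_dilation, Function.comp_def] using h'
  | algebraMap a => exact tendsto_const_nhds
  | add f f' _ _ h h' => exact h.add h'
  | mul f f' _ _ h h' => exact h.mul h'

open Filter Topology in
-- Homogeneity gives `f x = t ^ (-e) * f (μ(t) x)`. As `t → 0` the first factor tends to zero and
-- the second to `f 0`.
theorem IsHomogeneous.eq_zero {F : AdaptedFrame g} {e : ℝ} {f : derived s → ℂ}
    (h : F.IsHomogeneous e f) (hf : f ∈ F.polyFn) (he : e < 0) : f = 0 := by
  funext x
  have h1 : Tendsto (fun t : ℝ => ((t ^ (-e) : ℝ) : ℂ) * f (F.dilation t x)) (𝓝[>] 0) (𝓝 0) := by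
    have h2 : Tendsto (fun t : ℝ => t ^ (-e)) (𝓝[>] 0) (𝓝 0) := by
      have := (Real.continuousAt_rpow_const 0 (-e) (Or.inr (by linarith))).tendsto
      rw [Real.zero_rpow (by linarith)] at this
      exact this.mono_left nhdsWithin_le_nhds
    simpa using ((Complex.continuous_ofReal.tendsto _).comp h2).mul (F.tendsto_dilation hf x)
  refine tendsto_nhds_unique (Tendsto.congr' ?_ tendsto_const_nhds) h1
  filter_upwards [self_mem_nhdsWithin] with t ht
  rw [h t ht, ← mul_assoc, ← Complex.ofReal_mul, ← Real.rpow_add ht, neg_add_cancel,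
    Real.rpow_zero, Complex.ofReal_one, one_mul]

theorem eq_zero_of_mem_weightLE {d : ℝ} (hd : d < 0) {f : derived s → ℂ}
    (hf : f ∈ F.weightLE d) : f = 0 := by
  have : F.weightLE d ≤ ⊥ :=
    Submodule.span_le.mpr fun f ⟨hf, e, he, h⟩ => h.eq_zero hf (he.trans_lt hd)
  exact (Submodule.mem_bot ℂ).mp (this hf)

/-! ### The Laplace-Beltrami operator on functions independent of `t` -/

theorem leftInvariant_none (f : derived s → ℂ) (q : F.Group) :
    F.leftInvariant none (fun q => f q.x) q = 0 :=
  deriv_const 0 (f (bch F.m q.x (F.dilation q.t 0)))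

/-- Moving along `X p` fixes `t`, and `μ(t)` rescales the parameter by `t ^ λ`. The factor `φ`
absorbs this power when the lemma is applied a second time. -/
theorem leftInvariant_some (p : F.Index) (φ : ℝ → ℂ) (f : derived s → ℂ) (q : F.Group) :
    F.leftInvariant (some p) (fun q => φ q.t * f q.x) q =
      ((q.t ^ F.lam p.1 : ℝ) : ℂ) * (φ q.t * F.fieldDeriv p f q.x) := by
  have h : ∀ r : ℝ, φ (q * F.oneParam (some p) r).t * f (q * F.oneParam (some p) r).x =
      φ q.t * f (bch F.m q.x ((q.t ^ F.lam p.1 * r) • F.X p)) := by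
    intro r
    change φ (q.t * 1) * f (bch F.m q.x (F.dilation q.t (r • F.X p))) = _
    rw [mul_one, map_smul, F.dilation_X, smul_smul, mul_comm r]
  simp only [leftInvariant, h, deriv_const_mul_field]
  rw [deriv_comp_mul_left (q.t ^ F.lam p.1) (fun r : ℝ => f (bch F.m q.x (r • F.X p))) 0,
    mul_zero, Complex.real_smul, fieldDeriv]
  ring

theorem g_X_X (z : derived s) (p : F.Index) : g z (F.X p) = F.X.repr z p := by
  classical
  have h : g.flip (F.X p) ∘ₗ (derived s).toSubmodule.subtype = F.X.coord p := by
    refine F.X.ext fun q => ?_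
    rw [F.X.coord_apply, F.X.repr_self, Finsupp.single_apply]
    exact F.orthonormal q p
  exact LinearMap.congr_fun h z

/-- For `a = A`, use `𝔫 ⊥ A`. Otherwise `⁅X p, X a⁆` has weight `λ_p + λ_a ≠ λ_a`, so it is
orthogonal to `X a`. -/
theorem connection_some (a : Option F.Index) (p : F.Index) :
    F.connection a a (some p) = 0 := by
  cases a with
  | none =>
    have h : g (F.X p : s) F.A = 0 := F.A_mem _ (F.X p).2
    have h' : ⁅(F.X p : s), F.A⁆ = -(F.lam p.1 • (F.X p : s)) := by rw [← lie_skew, F.eigen]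
    simp [connection, frame, F.eigen, h', h]
  | some a =>
    have h : g ⁅(F.X p : s), (F.X a : s)⁆ (F.X a) = 0 := by
      rw [← F.repr_eq_zero_of_lie_A (F.lie_A_lie_X p a) (p := a), ← F.g_X_X]
      · rfl
      · linarith [F.lam_pos p.1]
    have h' : g ⁅(F.X a : s), (F.X p : s)⁆ (F.X a) = 0 := by
      rw [← lie_skew, map_neg, LinearMap.neg_apply, h, neg_zero]
    simp [connection, frame, h, h']

/-- The coefficient of `t ^ (2 λₖ)` in the tension of a function independent of `t`. -/
def tension (k : Fin F.m) (f : derived s → ℂ) : derived s → ℂ :=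
  ∑ j : Fin (F.dim k), F.fieldDeriv ⟨k, j⟩ (F.fieldDeriv ⟨k, j⟩ f)

theorem tau_eq_sum_tension (f : derived s → ℂ) (q : F.Group) :
    F.tau (fun q => f q.x) q =
      ∑ k, F.tension k f q.x * ((q.t ^ (2 * F.lam k) : ℝ) : ℂ) := by
  have hsome : ∀ p : F.Index,
      F.leftInvariant (some p) (F.leftInvariant (some p) (fun q => f q.x)) q =
        F.fieldDeriv p (F.fieldDeriv p f) q.x * ((q.t ^ (2 * F.lam p.1) : ℝ) : ℂ) := by
    intro p
    have h : F.leftInvariant (some p) (fun q => f q.x) =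
        fun q => ((q.t ^ F.lam p.1 : ℝ) : ℂ) * F.fieldDeriv p f q.x := by
      funext q
      simpa using F.leftInvariant_some p (fun _ => 1) f q
    rw [h, F.leftInvariant_some p (fun t => ((t ^ F.lam p.1 : ℝ) : ℂ)), two_mul,
      Real.rpow_add q.t_pos]
    push_cast
    ring
  have hnone : F.leftInvariant none (fun q => f q.x) = fun q => (fun _ => (0 : ℂ)) q.x :=
    funext fun q => F.leftInvariant_none f q
  have hconn : ∀ a, ∑ c, (F.connection a a c : ℂ) * F.leftInvariant c (fun q => f q.x) q = 0 := by
    intro a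
    refine Finset.sum_eq_zero fun c _ => ?_
    cases c with
    | none => rw [F.leftInvariant_none, mul_zero]
    | some p => rw [F.connection_some, Complex.ofReal_zero, zero_mul]
  simp only [tau, hconn, sub_zero, Fintype.sum_option, hsome]
  rw [hnone, F.leftInvariant_none fun _ => 0, zero_add, Fintype.sum_sigma]
  simp [tension, Finset.sum_mul]

theorem tension_mem_weightLE (k : Fin F.m) {d : ℝ} {f : derived s → ℂ} (hf : f ∈ F.weightLE d) :
    F.tension k f ∈ F.weightLE (d - 2 * F.lam k) := by
  refine sum_mem fun j _ => ?_
  have := F.fieldDeriv_mem_weightLE ⟨k, j⟩ (F.fieldDeriv_mem_weightLE ⟨k, j⟩ hf)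
  rwa [sub_sub, ← two_mul] at this

/-! ### The tension tree -/

/-- The nodes of the tension tree of a function of `x`. -/
def treeNode (f : derived s → ℂ) : (i : ℕ) → (Fin i → Fin F.m) → derived s → ℂ
  | 0, _ => f
  | i + 1, α => F.tension (α (Fin.last i)) (treeNode f i (Fin.init α))

theorem isTensionTree_treeNode (f : derived s → ℂ) :
    F.IsTensionTree (fun q => f q.x) (fun i α q => F.treeNode f i α q.x) where
  root _ := rfl
  independent i α p q h := by simp only [h]
  tau_eq i α q := by simp [F.tau_eq_sum_tension, treeNode]

theorem treeNode_mem_weightLE {ε : ℝ} (hε : ∀ k, ε ≤ 2 * F.lam k) {d : ℝ} {f : derived s → ℂ}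
    (hf : f ∈ F.weightLE d) (i : ℕ) (α : Fin i → Fin F.m) :
    F.treeNode f i α ∈ F.weightLE (d - i * ε) := by
  induction i with
  | zero => simpa [treeNode] using hf
  | succ i ih =>
    refine F.weightLE_mono ?_ (F.tension_mem_weightLE _ (ih (Fin.init α)))
    have := hε (α (Fin.last i))
    push_cast
    linarith

theorem degree_treeNode_lt_top {d : ℝ} {f : derived s → ℂ} (hf : f ∈ F.weightLE d) :
    F.degree (fun i α q => F.treeNode f i α q.x) < ⊤ := by
  -- A uniform weight loss per level: twice the least eigenvalue, or any positive number if `𝔫 = 0`.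
  obtain ⟨ε, hε0, hε⟩ : ∃ ε > 0, ∀ k, ε ≤ 2 * F.lam k := by
    rcases isEmpty_or_nonempty (Fin F.m) with h | h
    · exact ⟨1, one_pos, fun k => h.elim k⟩
    · obtain ⟨k, hk⟩ := Finite.exists_min F.lam
      exact ⟨2 * F.lam k, by linarith [F.lam_pos k], fun j => by linarith [hk j]⟩
  obtain ⟨r, hr⟩ := exists_nat_gt (d / ε)
  refine lt_of_le_of_lt (iInf₂_le r fun α q => ?_) (ENat.natCast_lt_top r)
  have h : d - ((r + 1 : ℕ) : ℝ) * ε < 0 := by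
    rw [div_lt_iff₀ hε0] at hr
    push_cast
    linarith
  exact congrFun (F.eq_zero_of_mem_weightLE h (F.treeNode_mem_weightLE hε hf (r + 1) α)) q.x

/-- By induction both trees have the same parent node. At fixed `x` its tension is a combination of
powers of `t` whose coefficients are the children. -/
theorem IsTensionTree.unique {F : AdaptedFrame g} {h : F.Group → ℂ} {T T' : F.Tree}
    (hT : F.IsTensionTree h T) (hT' : F.IsTensionTree h T') : T' = T := by
  funext i
  induction i with
  | zero => funext α; rw [hT.root, hT'.root]
  | succ i ih =>
    funext α q
    rw [← Fin.snoc_init_self α]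
    let c : Fin F.m → ℂ := fun k =>
      T' (i + 1) (Fin.snoc (α := fun _ => Fin F.m) (Fin.init α) k) q -
        T (i + 1) (Fin.snoc (α := fun _ => Fin F.m) (Fin.init α) k) q
    have hc : c = 0 := by
      refine eq_zero_of_sum_rpow (μ := fun k => 2 * F.lam k)
        (fun k k' hk => F.lam_strictMono.injective (by simpa using hk)) c fun t ht => ?_
      have h1 := hT.tau_eq i (Fin.init α) ⟨t, ht, q.x⟩
      have h2 := hT'.tau_eq i (Fin.init α) ⟨t, ht, q.x⟩
      rw [ih, h1] at h2
      simp only [c, sub_mul, Finset.sum_sub_distrib, sub_eq_zero]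
      simp only [fun k => hT.independent (i + 1) (Fin.snoc (α := fun _ => Fin F.m) (Fin.init α) k)
          q ⟨t, ht, q.x⟩ rfl,
        fun k => hT'.independent (i + 1) (Fin.snoc (α := fun _ => Fin F.m) (Fin.init α) k)
          q ⟨t, ht, q.x⟩ rfl]
      exact h2.symm
    exact sub_eq_zero.mp (congrFun hc (α (Fin.last i)))

end AdaptedFrame

end Iwasawa

end

/-! ### Existence, uniqueness and finite degree of the tension tree -/

theorem mainTheorem2 {s : Type*} [LieRing s] [LieAlgebra ℝ s] [FiniteDimensional ℝ s]
    (g : LinearMap.BilinForm ℝ s) (hg : Iwasawa.IsIwasawaType g) (hrank : Iwasawa.rank g = 1)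
    (F : Iwasawa.AdaptedFrame g) (h : F.Group → ℂ) (hh : F.IsPolynomialInX h) :
    ∃ T : F.Tree, F.IsTensionTree h T ∧ (∀ T' : F.Tree, F.IsTensionTree h T' → T' = T) ∧
      F.degree T < ⊤ := by
  obtain ⟨P, hP⟩ := hh
  obtain ⟨d, hd⟩ := F.exists_mem_weightLE P
  have hT := F.isTensionTree_treeNode fun x => MvPolynomial.eval (fun p => F.coordFn p x) P
  rw [show (fun q : F.Group => MvPolynomial.eval (fun p => F.coordFn p q.x) P) = h from
    funext fun q => (hP q).symm] at hT
  exact ⟨_, hT, fun _ hT' => hT.unique hT', F.degree_treeNode_lt_top hd⟩
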